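/- **Theorem (Factorisation Theorem).** Let $n\in\mathbb N$ and let $H$ be a complex Hilbert space of arbitrary dimension. Let $C(S^1)^{(n)}\subseteq M_n(\mathbb C)$ be the operator system of all complex $n\times n$ Toeplitz matrices, and let $C(S^1)^{(n)}\otimes_{\min}B(H)$ be the algebraic tensor product, whose elements are identified, via $r\otimes a\mapsto[r_{kj}a]_{k,j=1}^n$, with the block Toeplitz matrices $[\tau_{k-j}]_{k,j=1}^n$, $\tau_\ell\in B(H)$, acting as operators on $\mathbb C^n\otimes H=H\oplus\dots\oplus H$; such an element is called positive if it is a positive operator on $\mathbb C^n\otimes H$. For a unitary operator $u$ on a Hilbert space $K$, let $T_n(u)=[u^{k-j}]_{k,j=1}^n$, an operator on $\mathbb C^n\otimes K$. 1. If $T=[\tau_{k-j}]_{k,j=1}^n\in C(S^1)^{(n)}\otimes_{\min}B(H)$ is positive, then there exist a Hilbert space $K$, a unitary operator $u\in B(K)$, and a bounded linear operator $w:H\to K$ such that $$T=(1_n\otimes w)^*\,T_n(u)\,(1_n\otimes w),$$ where $1_n$ is the $n\times n$ identity matrix. 2. If, moreover, $T$ is positive and admits such a factorisation, for some Hilbert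 space $K$, unitary $u\in B(K)$ and bounded linear $w:H\to K$, in which $u$ has finite spectrum, then $T$ is separable: there are $m\in\mathbb N$, positive semidefinite Toeplitz matrices $r_1,\dots,r_m\in C(S^1)^{(n)}$ and positive operators $s_1,\dots,s_m\in B(H)$ such that $T=\sum_{i=1}^m r_i\otimes s_i$. -/

import Mathlib

open scoped TensorProduct ComplexOrder

universe v w

noncomputable section

/-- The Hilbert space `H ⊕ ⋯ ⊕ H` (`n` copies), i.e. the Hilbert space `ℂⁿ ⊗ H`. -/
abbrev HilbertSum (n : ℕ) (H : Type*) : Type _ := PiLp 2 (fun _ : Fin n => H)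

/-- The operator system `C(S¹)⁽ⁿ⁾` of complex `n × n` Toeplitz matrices `[τ_{k-j}]`, as a
subspace of the `n × n` matrices. -/
def toeplitzSystem (n : ℕ) : Submodule ℂ (Matrix (Fin n) (Fin n) ℂ) where
  carrier := {A | ∃ τ : ℤ → ℂ, ∀ k j : Fin n, A k j = τ ((k : ℤ) - (j : ℤ))}
  add_mem' := by
    rintro A B ⟨σ, hσ⟩ ⟨τ, hτ⟩
    exact ⟨fun l => σ l + τ l, fun k j => by rw [Matrix.add_apply, hσ, hτ]⟩
  zero_mem' := ⟨fun _ => 0, fun _ _ => rfl⟩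
  smul_mem' := by
    rintro c A ⟨τ, hτ⟩
    exact ⟨fun l => c * τ l, fun k j => by rw [Matrix.smul_apply, hτ, smul_eq_mul]⟩

section Operators

variable {H K : Type*} [NormedAddCommGroup H] [InnerProductSpace ℂ H]
  [NormedAddCommGroup K] [InnerProductSpace ℂ K]

/-- The bounded operator `x ↦ (∑ j, A k j (x j))ₖ` from `H ⊕ ⋯ ⊕ H` to `K ⊕ ⋯ ⊕ K` given by a
matrix `A` of bounded operators `H → K`. -/
def blockOperator {n : ℕ} (A : Matrix (Fin n) (Fin n) (H →L[ℂ] K)) :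
    HilbertSum n H →L[ℂ] HilbertSum n K :=
  ((PiLp.continuousLinearEquiv 2 ℂ (fun _ : Fin n => K)).symm :
      (Fin n → K) →L[ℂ] HilbertSum n K) ∘L
    ContinuousLinearMap.pi fun k => ∑ j, A k j ∘L PiLp.proj 2 (fun _ : Fin n => H) j

/-- The operator `1ₙ ⊗ w`. -/
def ampliation (n : ℕ) (w : H →L[ℂ] K) : HilbertSum n H →L[ℂ] HilbertSum n K :=
  blockOperator (Matrix.diagonal fun _ : Fin n => w)

/-- The operator matrix of an element of the algebraic tensor product `C(S¹)⁽ⁿ⁾ ⊗ B(H)`: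
the linear extension of `r ⊗ a ↦ [r_{kj} a]`. -/
def tensorToMatrix (n : ℕ) :
    toeplitzSystem n ⊗[ℂ] (H →L[ℂ] H) →ₗ[ℂ] Matrix (Fin n) (Fin n) (H →L[ℂ] H) :=
  TensorProduct.lift <|
    LinearMap.mk₂ ℂ
      (fun (r : toeplitzSystem n) (a : H →L[ℂ] H) =>
        (Matrix.of fun k j => (r : Matrix (Fin n) (Fin n) ℂ) k j • a))
      (fun r r' a => by ext1 k j; simp [add_smul])
      (fun c r a => by ext1 k j; simp [mul_smul])
      (fun r a a' => by ext1 k j; simp [smul_add])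
      (fun c r a => by ext1 k j; simp [smul_smul, mul_comm])

/-- The operator on `ℂⁿ ⊗ H` represented by an element of `C(S¹)⁽ⁿ⁾ ⊗ B(H)`. -/
def tensorToOperator {n : ℕ} (T : toeplitzSystem n ⊗[ℂ] (H →L[ℂ] H)) :
    HilbertSum n H →L[ℂ] HilbertSum n H :=
  blockOperator (tensorToMatrix n T)

/-- Positivity in the spatial (minimal) tensor product `C(S¹)⁽ⁿ⁾ ⊗_min B(H)`, whose order is
inherited from `Mₙ(ℂ) ⊗ B(H) = B(ℂⁿ ⊗ H)`. -/
def IsMinPositive {n : ℕ} (T : toeplitzSystem n ⊗[ℂ] (H →L[ℂ] H)) : Prop :=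
  (tensorToOperator T).IsPositive

/-- `T` is separable: a finite sum of tensors `r ⊗ s` of positive elements. -/
def IsTensorSeparable {n : ℕ} (T : toeplitzSystem n ⊗[ℂ] (H →L[ℂ] H)) : Prop :=
  ∃ (m : ℕ) (r : Fin m → toeplitzSystem n) (s : Fin m → (H →L[ℂ] H)),
    (∀ i, (r i : Matrix (Fin n) (Fin n) ℂ).PosSemidef) ∧ (∀ i, (s i).IsPositive) ∧
      T = ∑ i, r i ⊗ₜ[ℂ] s i

/-- `Tₙ(u)`: the operator on `K ⊕ ⋯ ⊕ K` whose `(k, j)` entry is the integral power `u^(k-j)`. -/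
def universalToeplitz (n : ℕ) [CompleteSpace K] (u : unitary (K →L[ℂ] K)) :
    HilbertSum n K →L[ℂ] HilbertSum n K :=
  blockOperator (Matrix.of fun k j : Fin n =>
    ((u ^ ((k : ℤ) - (j : ℤ)) : unitary (K →L[ℂ] K)) : K →L[ℂ] K))

/-- The factorisation `T = (1ₙ ⊗ w)* Tₙ(u) (1ₙ ⊗ w)`, as operators on `ℂⁿ ⊗ H`. -/
def FactorsThrough {n : ℕ} [CompleteSpace H] [CompleteSpace K]
    (T : toeplitzSystem n ⊗[ℂ] (H →L[ℂ] H)) (u : unitary (K →L[ℂ] K)) (w : H →L[ℂ] K) : Prop :=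
  tensorToOperator T =
    ContinuousLinearMap.adjoint (ampliation n w) ∘L universalToeplitz n u ∘L ampliation n w

end Operators

end

/-! ### Operator matrices and the tensor product -/

section Blocks

variable {H K : Type*} [NormedAddCommGroup H] [InnerProductSpace ℂ H]
  [NormedAddCommGroup K] [InnerProductSpace ℂ K]

/-! Positivity of `T` gives `V k : H → Hⁿ` with `(V k)* V j = τ_{k-j}` (`exists_gram`). These Gram
entries depend only on `k - j`, so `V j x ↦ V (j+1) x` is isometric; it extends to a partial
isometry and dilates to a unitary `U` with `U^j V 0 = V j` (`exists_unitary_dilation`). Hence `u =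
U⁻¹`, `w = V 0` factor `T`. If `u` has finite spectrum, then `u^l = ∑ z^l p_z` with positive `p_z`,
so `T = ∑ [z^(k-j)] ⊗ w* p_z w`. -/

theorem blockOperator_apply {n : ℕ} (A : Matrix (Fin n) (Fin n) (H →L[ℂ] K))
    (x : HilbertSum n H) (k : Fin n) : blockOperator A x k = ∑ j, A k j (x j) := by
  simp [blockOperator]

theorem blockOperator_single {n : ℕ} (A : Matrix (Fin n) (Fin n) (H →L[ℂ] K))
    (j k : Fin n) (x : H) : blockOperator A (PiLp.single 2 j x) k = A k j x := by
  rw [blockOperator_apply, Finset.sum_eq_single j]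
  · simp
  · intro i _ hi
    simp [hi]
  · simp

theorem blockOperator_injective {n : ℕ} :
    Function.Injective (blockOperator : Matrix (Fin n) (Fin n) (H →L[ℂ] K) → _) := by
  intro A B h
  ext k j x
  rw [← blockOperator_single A, h, blockOperator_single]

theorem ampliation_apply {n : ℕ} (w : H →L[ℂ] K) (x : HilbertSum n H) (k : Fin n) :
    ampliation n w x k = w (x k) := by
  rw [ampliation, blockOperator_apply, Finset.sum_eq_single k]
  · simp
  · intro i _ hi
    simp [Matrix.diagonal_apply_ne' _ hi]
  · simp

theorem adjoint_ampliation [CompleteSpace H] [CompleteSpace K] (n : ℕ) (w : H →L[ℂ] K) :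
    ContinuousLinearMap.adjoint (ampliation n w) =
      ampliation n (ContinuousLinearMap.adjoint w) := by
  symm
  rw [ContinuousLinearMap.eq_adjoint_iff]
  intro x y
  simp [PiLp.inner_apply, ampliation_apply, ContinuousLinearMap.adjoint_inner_left]

/-- A factorisation is an identity between matrix entries. -/
theorem factorsThrough_iff [CompleteSpace H] [CompleteSpace K] {n : ℕ}
    (T : toeplitzSystem n ⊗[ℂ] (H →L[ℂ] H)) (u : unitary (K →L[ℂ] K)) (w : H →L[ℂ] K) :
    FactorsThrough T u w ↔ ∀ k j : Fin n, tensorToMatrix n T k j =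
      ContinuousLinearMap.adjoint w ∘L
        ((u ^ ((k : ℤ) - (j : ℤ)) : unitary (K →L[ℂ] K)) : K →L[ℂ] K) ∘L w := by
  have key : ContinuousLinearMap.adjoint (ampliation n w) ∘L universalToeplitz n u ∘L
      ampliation n w = blockOperator (Matrix.of fun k j : Fin n =>
        ContinuousLinearMap.adjoint w ∘L
          ((u ^ ((k : ℤ) - (j : ℤ)) : unitary (K →L[ℂ] K)) : K →L[ℂ] K) ∘L w) := by
    ext x k
    simp [adjoint_ampliation, ampliation_apply, universalToeplitz, blockOperator_apply]
  rw [FactorsThrough, key, tensorToOperator, blockOperator_injective.eq_iff, ← Matrix.ext_iff]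
  rfl

theorem tensorToMatrix_tmul {n : ℕ} (r : toeplitzSystem n) (a : H →L[ℂ] H) (k j : Fin n) :
    tensorToMatrix n (r ⊗ₜ[ℂ] a) k j = (r : Matrix (Fin n) (Fin n) ℂ) k j • a := by
  simp [tensorToMatrix]

/-- The matrix entries determine `∑ E_kj ⊗ M_kj` in the full tensor product `Mₙ ⊗ B(H)`, and the
Toeplitz tensors embed there by flatness. -/
theorem tensorToMatrix_injective (n : ℕ) :
    Function.Injective (tensorToMatrix (H := H) n) := by
  let Φ : Matrix (Fin n) (Fin n) (H →L[ℂ] H) → Matrix (Fin n) (Fin n) ℂ ⊗[ℂ] (H →L[ℂ] H) :=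
    fun M => ∑ k, ∑ j, Matrix.single k j (1 : ℂ) ⊗ₜ[ℂ] M k j
  have hΦ : ∀ T, Φ (tensorToMatrix n T) =
      LinearMap.rTensor (H →L[ℂ] H) (toeplitzSystem n).subtype T := by
    intro T
    induction T using TensorProduct.induction_on with
    | zero => simp [Φ]
    | tmul r a =>
      simp only [Φ, tensorToMatrix_tmul, LinearMap.rTensor_tmul, Submodule.subtype_apply]
      conv_rhs => rw [Matrix.matrix_eq_sum_single (r : Matrix (Fin n) (Fin n) ℂ)]
      simp only [TensorProduct.sum_tmul, TensorProduct.tmul_smul, TensorProduct.smul_tmul',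
        Matrix.smul_single, smul_eq_mul, mul_one]
    | add S T hS hT =>
      rw [map_add, map_add, ← hS, ← hT]
      simp [Φ, TensorProduct.tmul_add, Finset.sum_add_distrib]
  have hinj := Module.Flat.rTensor_preserves_injective_linearMap (M := H →L[ℂ] H)
    (toeplitzSystem n).subtype (toeplitzSystem n).injective_subtype
  intro S T h
  apply hinj
  rw [← hΦ, ← hΦ, h]

theorem tensorToMatrix_toeplitz {n : ℕ} (T : toeplitzSystem n ⊗[ℂ] (H →L[ℂ] H))
    {k j k' j' : Fin n} (h : (k : ℤ) - j = k' - j') :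
    tensorToMatrix n T k j = tensorToMatrix n T k' j' := by
  induction T using TensorProduct.induction_on with
  | zero => simp
  | tmul r a =>
    obtain ⟨τ, hτ⟩ := r.2
    rw [tensorToMatrix_tmul, tensorToMatrix_tmul, hτ, hτ, h]
  | add S T hS hT => simp [hS, hT]

end Blocks

/-! ### Extending isometries to unitaries -/

section Dilation

variable {K : Type*} [NormedAddCommGroup K] [InnerProductSpace ℂ K] [CompleteSpace K]

/-- Two families of vectors with the same norms are intertwined by a partial isometry. -/
theorem exists_partialIsometry {E : Type*} [AddCommGroup E] [Module ℂ E] (X Y : E →ₗ[ℂ] K)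
    (h : ∀ x, ‖X x‖ = ‖Y x‖) :
    ∃ W : K →L[ℂ] K, W ∘L ContinuousLinearMap.adjoint W ∘L W = W ∧ (∀ x, W (X x) = Y x) ∧
      ∀ x, ContinuousLinearMap.adjoint W (W (X x)) = X x := by
  let A : Submodule ℂ K := (LinearMap.range X).topologicalClosure
  have : CompleteSpace A :=
    (LinearMap.range X).isClosed_topologicalClosure.completeSpace_coe
  let e : E →ₗ[ℂ] A := X.codRestrict A fun x =>
    (LinearMap.range X).le_topologicalClosure ⟨x, rfl⟩
  have hd : DenseRange e := by
    intro a
    rw [closure_subtype]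
    have : Subtype.val '' Set.range e = (LinearMap.range X : Set K) := by
      ext y
      simp [e]
    rw [this]
    exact a.2
  have hb : ∃ C : ℝ, ∀ x, ‖Y x‖ ≤ C * ‖e x‖ := ⟨1, fun x => by simp [e, h]⟩
  -- `X x ↦ Y x` extends isometrically to the closure `A` of the range; precomposing with the
  -- projection onto `A` makes it zero on the complement.
  let W₀ : A →L[ℂ] K := Y.extendOfNorm e
  have hW₀ : ∀ x, W₀ (e x) = Y x := LinearMap.extendOfNorm_eq hd hb
  have hiso : ∀ a, ‖W₀ a‖ = ‖a‖ := fun a =>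
    hd.induction (P := fun a => ‖W₀ a‖ = ‖a‖)
      (by rintro _ ⟨x, rfl⟩; rw [hW₀, ← h]; rfl)
      (isClosed_eq (by fun_prop) (by fun_prop)) a
  have hadj : ∀ a, ContinuousLinearMap.adjoint W₀ (W₀ a) = a := fun a => by
    have := (ContinuousLinearMap.norm_map_iff_adjoint_comp_self W₀).1 hiso
    exact DFunLike.congr_fun this a
  have hW : ∀ x, ContinuousLinearMap.adjoint (W₀ ∘L A.orthogonalProjectionOnto)
      ((W₀ ∘L A.orthogonalProjectionOnto) x) = A.orthogonalProjectionOnto x := fun x => by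
    simp [ContinuousLinearMap.adjoint_comp, hadj, Submodule.adjoint_orthogonalProjectionOnto]
  have hX : ∀ x, A.orthogonalProjectionOnto (X x) = e x := fun x =>
    A.orthogonalProjectionOnto_mem_subspace_eq_self (e x)
  refine ⟨W₀ ∘L A.orthogonalProjectionOnto, ?_, fun x => ?_, fun x => ?_⟩
  · ext x
    simp only [ContinuousLinearMap.comp_apply] at hW ⊢
    rw [hW, A.orthogonalProjectionOnto_mem_subspace_eq_self]
  · rw [ContinuousLinearMap.comp_apply, hX, hW₀]
  · rw [hW, hX]
    rfl

/-- The Halmos dilation of a partial isometry `W` on `K` is a unitary on `K ⊕ K`, which agrees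
with `W` on the initial space of `W`. -/
theorem exists_unitary_of_partialIsometry (W : K →L[ℂ] K)
    (hW : W ∘L ContinuousLinearMap.adjoint W ∘L W = W) :
    ∃ U : unitary (WithLp 2 (K × K) →L[ℂ] WithLp 2 (K × K)), ∀ x,
      ContinuousLinearMap.adjoint W (W x) = x →
        (U : WithLp 2 (K × K) →L[ℂ] WithLp 2 (K × K)) (WithLp.toLp 2 (x, 0)) =
          WithLp.toLp 2 (W x, 0) := by
  -- The block matrix `[[V, 1 - VV*], [1 - V*V, -V*]]`. Its adjoint is the same construction for
  -- `V*`, so one product computation, used for `W` and for `W*`, gives unitarity.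
  let halmos (V : K →L[ℂ] K) : WithLp 2 (K × K) →L[ℂ] WithLp 2 (K × K) :=
    ((WithLp.prodContinuousLinearEquiv 2 ℂ K K).symm : K × K →L[ℂ] WithLp 2 (K × K)) ∘L
      ContinuousLinearMap.prod
        (V ∘L WithLp.fstL 2 ℂ K K +
          (1 - V ∘L ContinuousLinearMap.adjoint V) ∘L WithLp.sndL 2 ℂ K K)
        ((1 - ContinuousLinearMap.adjoint V ∘L V) ∘L WithLp.fstL 2 ℂ K K -
          ContinuousLinearMap.adjoint V ∘L WithLp.sndL 2 ℂ K K)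
  have apply_fst (V : K →L[ℂ] K) (z : WithLp 2 (K × K)) : (halmos V z).fst =
      V z.fst + (z.snd - V (ContinuousLinearMap.adjoint V z.snd)) := by simp [halmos]
  have apply_snd (V : K →L[ℂ] K) (z : WithLp 2 (K × K)) : (halmos V z).snd =
      (z.fst - ContinuousLinearMap.adjoint V (V z.fst)) - ContinuousLinearMap.adjoint V z.snd := by
    simp [halmos]
  have adj (V : K →L[ℂ] K) :
      halmos (ContinuousLinearMap.adjoint V) = ContinuousLinearMap.adjoint (halmos V) := by
    rw [ContinuousLinearMap.eq_adjoint_iff]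
    intro x y
    simp only [WithLp.prod_inner_apply, ← WithLp.fst.eq_1, ← WithLp.snd.eq_1, apply_fst, apply_snd,
      inner_add_left, inner_sub_left, inner_add_right, inner_sub_right, ContinuousLinearMap.adjoint_adjoint,
      ContinuousLinearMap.adjoint_inner_left, ← ContinuousLinearMap.adjoint_inner_right V]
    ring
  have mul_eq (V : K →L[ℂ] K) (hV : V ∘L ContinuousLinearMap.adjoint V ∘L V = V) :
      halmos (ContinuousLinearMap.adjoint V) * halmos V = 1 := by
    have h1 : ∀ x, V (ContinuousLinearMap.adjoint V (V x)) = V x := DFunLike.congr_fun hV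
    have h2 : ∀ x, ContinuousLinearMap.adjoint V (V (ContinuousLinearMap.adjoint V x)) =
        ContinuousLinearMap.adjoint V x := by
      have := congrArg ContinuousLinearMap.adjoint hV
      simp only [ContinuousLinearMap.adjoint_comp, ContinuousLinearMap.adjoint_adjoint] at this
      exact DFunLike.congr_fun this
    refine ContinuousLinearMap.ext fun z => WithLp.ofLp_injective 2 (Prod.ext ?_ ?_)
    · refine (apply_fst _ (halmos V z)).trans ?_
      simp [apply_fst, apply_snd, h1, h2]
    · refine (apply_snd _ (halmos V z)).trans ?_
      simp [apply_fst, apply_snd, h1, h2]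
  have hW' : ContinuousLinearMap.adjoint W ∘L
      ContinuousLinearMap.adjoint (ContinuousLinearMap.adjoint W) ∘L
        ContinuousLinearMap.adjoint W = ContinuousLinearMap.adjoint W := by
    have := congrArg ContinuousLinearMap.adjoint hW
    simpa only [ContinuousLinearMap.adjoint_comp, ContinuousLinearMap.comp_assoc] using this
  refine ⟨⟨halmos W, ?_⟩, fun x hx => ?_⟩
  · rw [Unitary.mem_iff, ContinuousLinearMap.star_eq_adjoint, ← adj]
    refine ⟨mul_eq W hW, ?_⟩
    simpa using mul_eq _ hW'
  · refine WithLp.ofLp_injective 2 (Prod.ext ?_ ?_)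
    · exact (apply_fst W _).trans (by simp)
    · exact (apply_snd W _).trans (by simp [hx])

end Dilation

/-! ### Existence of the factorisation -/

section Factorisation

variable {H : Type*} [NormedAddCommGroup H] [InnerProductSpace ℂ H] [CompleteSpace H]

/-- Kolmogorov decomposition of a positive operator matrix. -/
theorem exists_gram {n : ℕ} (A : Matrix (Fin n) (Fin n) (H →L[ℂ] H))
    (hA : (blockOperator A).IsPositive) :
    ∃ V : Fin n → H →L[ℂ] HilbertSum n H, ∀ k j x y,
      inner ℂ (V k x) (V j y) = inner ℂ x (A k j y) := by
  have h0 : 0 ≤ blockOperator A := (ContinuousLinearMap.nonneg_iff_isPositive _).2 hA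
  let S := CFC.sqrt (blockOperator A)
  have hS : S * S = blockOperator A := CFC.sqrt_mul_sqrt_self _ h0
  have hSa : ContinuousLinearMap.adjoint S = S :=
    (IsSelfAdjoint.of_nonneg (CFC.sqrt_nonneg (blockOperator A))).adjoint_eq
  let ι : Fin n → H →L[ℂ] HilbertSum n H := fun j =>
    ((PiLp.continuousLinearEquiv 2 ℂ (fun _ : Fin n => H)).symm :
      (Fin n → H) →L[ℂ] HilbertSum n H) ∘L ContinuousLinearMap.single ℂ (fun _ : Fin n => H) j
  have hι : ∀ j x, ι j x = PiLp.single 2 j x := fun j x => rfl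
  refine ⟨fun j => S ∘L ι j, fun k j x y => ?_⟩
  change inner ℂ (S (ι k x)) (S (ι j y)) = _
  rw [← ContinuousLinearMap.adjoint_inner_right, hSa, ← mul_apply_eq_comp, hS, hι, hι,
    PiLp.inner_apply, Finset.sum_eq_single k]
  · rw [blockOperator_single]
    simp
  · intro i _ hi
    simp [hi]
  · simp

/-- The inverse appears because `(u^k)* u^j = u^(j-k)`, while the Toeplitz convention is `k - j`. -/
theorem factorsThrough_inv {K : Type*} [NormedAddCommGroup K] [InnerProductSpace ℂ K]
    [CompleteSpace K] {n : ℕ} (T : toeplitzSystem n ⊗[ℂ] (H →L[ℂ] H))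
    (u : unitary (K →L[ℂ] K)) (w : H →L[ℂ] K)
    (h : ∀ (k j : Fin n) x y, inner ℂ x (tensorToMatrix n T k j y) =
      inner ℂ (((u ^ (k : ℤ) : unitary _) : K →L[ℂ] K) (w x))
        (((u ^ (j : ℤ) : unitary _) : K →L[ℂ] K) (w y))) :
    FactorsThrough T u⁻¹ w := by
  refine (factorsThrough_iff _ _ _).2 fun k j => ?_
  have hu : u⁻¹ ^ ((k : ℤ) - (j : ℤ)) = star (u ^ (k : ℤ)) * u ^ (j : ℤ) := by
    rw [Unitary.star_eq_inv, inv_zpow', neg_sub, sub_eq_neg_add, zpow_add, zpow_neg]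
  ext y
  refine ext_inner_left ℂ fun x => ?_
  rw [h, ContinuousLinearMap.comp_apply, ContinuousLinearMap.adjoint_inner_right,
    ← ContinuousLinearMap.adjoint_inner_right, hu]
  rfl

theorem exists_unitary_dilation {n : ℕ} (T : toeplitzSystem (n + 1) ⊗[ℂ] (H →L[ℂ] H))
    (hT : IsMinPositive T) :
    ∃ (u : unitary (WithLp 2 (HilbertSum (n + 1) H × HilbertSum (n + 1) H) →L[ℂ]
        WithLp 2 (HilbertSum (n + 1) H × HilbertSum (n + 1) H)))
      (w : H →L[ℂ] WithLp 2 (HilbertSum (n + 1) H × HilbertSum (n + 1) H)),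
      FactorsThrough T u w := by
  obtain ⟨V, hV⟩ := exists_gram _ hT
  let X (f : Fin n → Fin (n + 1)) : (Fin n → H) →ₗ[ℂ] HilbertSum (n + 1) H :=
    ∑ j, (V (f j) : H →ₗ[ℂ] HilbertSum (n + 1) H) ∘ₗ LinearMap.proj j
  have hX : ∀ f x, X f x = ∑ j, V (f j) (x j) := fun f x => by simp [X]
  have hXs : ∀ f j x, X f (Pi.single j x) = V (f j) x := fun f j x => by
    rw [hX, Finset.sum_eq_single j]
    · simp
    · intro i _ hi
      simp [hi]
    · simp
  -- The Toeplitz property enters here: raising both indices by one preserves the Gram entries.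
  have hnorm : ∀ x, ‖X Fin.castSucc x‖ = ‖X Fin.succ x‖ := fun x => by
    rw [@norm_eq_sqrt_re_inner ℂ, @norm_eq_sqrt_re_inner ℂ _ _ _ _ (X Fin.succ x)]
    congr 2
    simp only [hX, sum_inner, inner_sum, hV]
    refine Finset.sum_congr rfl fun i _ => Finset.sum_congr rfl fun j _ => ?_
    rw [tensorToMatrix_toeplitz T (k' := Fin.succ _) (j' := Fin.succ _)]
    simp
  obtain ⟨W, hW, hWX, hWW⟩ := exists_partialIsometry _ _ hnorm
  obtain ⟨U, hU⟩ := exists_unitary_of_partialIsometry W hW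
  let ι : HilbertSum (n + 1) H →L[ℂ] WithLp 2 (HilbertSum (n + 1) H × HilbertSum (n + 1) H) :=
    ((WithLp.prodContinuousLinearEquiv 2 ℂ (HilbertSum (n + 1) H) (HilbertSum (n + 1) H)).symm :
      HilbertSum (n + 1) H × HilbertSum (n + 1) H →L[ℂ] _) ∘L ContinuousLinearMap.inl ℂ _ _
  have hι : ∀ x y, inner ℂ (ι x) (ι y) = inner ℂ x y := fun x y => by
    simp [ι, WithLp.prod_inner_apply]
  -- By `hWW` these vectors lie in the initial space of `W`, where `U` agrees with `W`.
  have hstep : ∀ (j : Fin n) x, (U : _ →L[ℂ] _) (ι (V j.castSucc x)) = ι (V j.succ x) := by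
    intro j x
    have := hU (X Fin.castSucc (Pi.single j x)) (hWW _)
    rwa [hWX, hXs, hXs] at this
  have hpow : ∀ (j : Fin (n + 1)) x,
      ι (V j x) = ((U ^ (j : ℤ) : unitary _) : _ →L[ℂ] _) (ι (V 0 x)) := by
    intro j
    induction j using Fin.induction with
    | zero => simp
    | succ j ih =>
      intro x
      rw [← hstep, ih]
      simp only [Fin.val_castSucc, Fin.val_succ, zpow_natCast, pow_succ']
      rfl
  refine ⟨U⁻¹, ι ∘L V 0, factorsThrough_inv T U _ fun k j x y => ?_⟩
  rw [← hV, ← hι, hpow k, hpow j]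
  rfl

end Factorisation

/-! ### Finite spectrum and separability -/

section FiniteSpectrum

variable {K : Type*} [NormedAddCommGroup K] [InnerProductSpace ℂ K] [CompleteSpace K]

/-- Spectral decomposition of the powers of a unitary with finite spectrum. -/
theorem exists_spectral_decomposition (u : unitary (K →L[ℂ] K))
    (hu : (spectrum ℂ (u : K →L[ℂ] K)).Finite) :
    ∃ p : ℂ → K →L[ℂ] K, (∀ z, (p z).IsPositive) ∧ ∀ l : ℤ,
      ((u ^ l : unitary (K →L[ℂ] K)) : K →L[ℂ] K) = ∑ z ∈ hu.toFinset, z ^ l • p z := by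
  classical
  have hc : ∀ f : ℂ → ℂ, ContinuousOn f (spectrum ℂ (u : K →L[ℂ] K)) := fun f =>
    hu.continuousOn f
  -- Point indicators are continuous on a finite spectrum, so the functional calculus yields the
  -- spectral projections.
  refine ⟨fun z => cfc (fun x => if x = z then (1 : ℂ) else 0) (u : K →L[ℂ] K), fun z => ?_,
    fun l => ?_⟩
  · rw [← ContinuousLinearMap.nonneg_iff_isPositive]
    refine cfc_nonneg fun x _ => ?_
    split_ifs <;> simp
  · have hn : IsStarNormal ((Unitary.toUnits u : (K →L[ℂ] K)ˣ) : K →L[ℂ] K) :=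
      inferInstanceAs (IsStarNormal (u : K →L[ℂ] K))
    have h := cfc_zpow (R := ℂ) (Unitary.toUnits u) l hn
    rw [← map_zpow] at h
    refine h.symm.trans ?_
    rw [← Finset.sum_congr rfl fun z _ => cfc_const_mul (z ^ l) _ (u : K →L[ℂ] K) (hc _),
      ← cfc_sum _ _ _ fun z _ => hc _]
    refine cfc_congr fun x hx => ?_
    have hx' : x ∈ spectrum ℂ (u : K →L[ℂ] K) := hx
    simp [Finset.sum_apply, hx']

/-- The Toeplitz matrix `[z^(k-j)]`. -/
noncomputable def powerToeplitz (n : ℕ) (z : ℂ) : toeplitzSystem n :=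
  ⟨Matrix.of fun k j => z ^ ((k : ℤ) - (j : ℤ)), fun l => z ^ l, fun _ _ => rfl⟩

/-- On the unit circle `z⁻¹` is the conjugate of `z`, so the matrix is `v v*` with `v_k = z^k`. -/
theorem powerToeplitz_posSemidef (n : ℕ) {z : ℂ} (hz : ‖z‖ = 1) :
    (powerToeplitz n z : Matrix (Fin n) (Fin n) ℂ).PosSemidef := by
  have h0 : z ≠ 0 := norm_ne_zero_iff.1 (by simp [hz])
  have : (powerToeplitz n z : Matrix (Fin n) (Fin n) ℂ) =
      Matrix.vecMulVec (fun k : Fin n => z ^ (k : ℤ)) (star fun k : Fin n => z ^ (k : ℤ)) := by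
    ext k j
    simp [powerToeplitz, Matrix.vecMulVec_apply, zpow_sub₀ h0, div_eq_mul_inv,
      ← starRingEnd_apply, ← Complex.inv_eq_conj hz]
  rw [this]
  exact Matrix.posSemidef_vecMulVec_self_star _

theorem isTensorSeparable_of_finite_spectrum {H : Type*} [NormedAddCommGroup H]
    [InnerProductSpace ℂ H] [CompleteSpace H] {n : ℕ} (T : toeplitzSystem n ⊗[ℂ] (H →L[ℂ] H))
    (u : unitary (K →L[ℂ] K)) (w : H →L[ℂ] K) (hT : FactorsThrough T u w)
    (hu : (spectrum ℂ (u : K →L[ℂ] K)).Finite) : IsTensorSeparable T := by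
  obtain ⟨p, hp, hpow⟩ := exists_spectral_decomposition u hu
  rw [factorsThrough_iff] at hT
  let e := hu.toFinset.equivFin
  refine ⟨hu.toFinset.card, fun i => powerToeplitz n (e.symm i : ℂ),
    fun i => ContinuousLinearMap.adjoint w ∘L p (e.symm i : ℂ) ∘L w, fun i => ?_,
    fun i => (hp _).adjoint_conj w, ?_⟩
  · apply powerToeplitz_posSemidef
    have hmem := spectrum.subset_circle_of_unitary u.2 (hu.mem_toFinset.1 (e.symm i).2)
    simpa using hmem
  · rw [Equiv.sum_comp e.symm (fun z : hu.toFinset => powerToeplitz n (z : ℂ) ⊗ₜ[ℂ]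
        (ContinuousLinearMap.adjoint w ∘L p (z : ℂ) ∘L w)),
      Finset.sum_coe_sort hu.toFinset (fun z : ℂ => powerToeplitz n z ⊗ₜ[ℂ]
        (ContinuousLinearMap.adjoint w ∘L p z ∘L w))]
    apply tensorToMatrix_injective
    ext1 k j
    rw [hT, hpow, map_sum, Matrix.sum_apply]
    ext x
    simp [tensorToMatrix_tmul, powerToeplitz]

end FiniteSpectrum

theorem mainTheorem5 {H : Type v} [NormedAddCommGroup H] [InnerProductSpace ℂ H]
    [CompleteSpace H] (n : ℕ) (T : toeplitzSystem n ⊗[ℂ] (H →L[ℂ] H)) (hT : IsMinPositive T) :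
    (∃ (K : Type v) (_ : NormedAddCommGroup K) (_ : InnerProductSpace ℂ K) (_ : CompleteSpace K)
        (u : unitary (K →L[ℂ] K)) (w : H →L[ℂ] K), FactorsThrough T u w) ∧
      ∀ (K : Type w) [NormedAddCommGroup K] [InnerProductSpace ℂ K] [CompleteSpace K]
        (u : unitary (K →L[ℂ] K)) (w : H →L[ℂ] K), FactorsThrough T u w →
          (spectrum ℂ (u : K →L[ℂ] K)).Finite → IsTensorSeparable T := by
  refine ⟨?_, fun K _ _ _ u w h hu => isTensorSeparable_of_finite_spectrum T u w h hu⟩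
  cases n with
  | zero => exact ⟨H, _, _, inferInstance, 1, 0, (factorsThrough_iff _ _ _).2 fun k => k.elim0⟩
  | succ n =>
    obtain ⟨u, w, h⟩ := exists_unitary_dilation T hT
    exact ⟨_, _, _, inferInstance, u, w, h⟩
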